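/- Let $G$ be a finite group of exponent $m$, let $S\subseteq G$ be conjugate-closed (i.e. $g^{-1}sg\in S$ for all $s\in S$, $g\in G$), and let $\Gamma=\mathrm{BCay}(G,S)$ be the undirected graph whose vertex set is the disjoint union of two copies $G_1=\{g_1\mid g\in G\}$ and $G_2=\{g_2\mid g\in G\}$ of $G$ and whose edges are the pairs $\{g_1,(sg)_2\}$ with $g\in G$, $s\in S$. The splitting field $\mathrm{SF}(\Gamma)\subseteq\mathbb{C}$ is the field generated over $\mathbb{Q}$ by all eigenvalues of the adjacency matrix of $\Gamma$, and $\deg(\Gamma)=[\mathrm{SF}(\Gamma):\mathbb{Q}]$. Let $\omega_m\in\mathbb{C}$ be a primitive $m$-th root of unity, and let $\eta:\mathrm{Gal}(\mathbb{Q}(\omega_m)/\mathbb{Q})\to\mathbb{Z}_m^*=(\mathbb{Z}/m\mathbb{Z})^{\times}$ send $\sigma$ to the $t$ with $\sigma(\omega_m)=\omega_m^t$. For a multiset $X$ of elements of $G$ write $X^t=[x^t\mid x\in X]$, and let $SS^{-1}=[xy^{-1}\mid x,y\in S]$, both as multisets (counted with multiplicity). Put $$T=\{t\in\mathbb{Z}_m^*\mid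 (SS^{-1})^t=SS^{-1}\},\qquad K=\{x\in\mathbb{Q}(\omega_m)\mid \sigma(x)=x\ \text{for all}\ \sigma\in\eta^{-1}(T)\}.$$ Let $\mathrm{Irr}(G)$ be the set of irreducible complex characters of $G$, and write $\chi(S)=\sum_{s\in S}\chi(s)$. Then $|\chi(S)|^2\in K$ for every $\chi\in\mathrm{Irr}(G)$; the splitting field of $\Gamma$ is $$\mathrm{SF}(\Gamma)=K\bigl(|\chi(S)|\ \big|\ \chi\in\mathrm{Irr}(G)\bigr),$$ which is a finite extension of $\mathbb{Q}$; and $$\deg(\Gamma)=\frac{\varphi(m)\,|M|}{|T|},$$ where $\varphi$ is Euler's function and $M$ is the subgroup of $K^{\times}/(K^{\times})^2$ generated by the classes $[|\chi(S)|^2]_K$ for those $\chi\in\mathrm{Irr}(G)$ with $\chi(S)\neq 0$. -/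

import Mathlib

open scoped IntermediateField

noncomputable section

/-- A subset `S` of a group is conjugate-closed if `g⁻¹ s g ∈ S` for all `s ∈ S` and all `g`. -/
def ConjugateClosed {G : Type*} [Group G] (S : Finset G) : Prop :=
  ∀ s ∈ S, ∀ g : G, g⁻¹ * s * g ∈ S

/-- The bi-Cayley graph `BCay(G, S)`: the vertex set is the disjoint union of two copies
`G₁ = {inl g}` and `G₂ = {inr g}` of `G`, and the edges are the pairs `{g₁, (s g)₂}`
with `g ∈ G` and `s ∈ S`. -/
def BCay {G : Type*} [Group G] (S : Finset G) : SimpleGraph (G ⊕ G) where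
  Adj x y :=
    (∃ g : G, ∃ s ∈ S, x = Sum.inl g ∧ y = Sum.inr (s * g)) ∨
      (∃ g : G, ∃ s ∈ S, y = Sum.inl g ∧ x = Sum.inr (s * g))
  symm := ⟨fun _ _ h => h.symm⟩
  loopless := ⟨by
    rintro x (⟨g, s, _, h₁, h₂⟩ | ⟨g, s, _, h₁, h₂⟩) <;> exact Sum.inl_ne_inr (h₁.symm.trans h₂)⟩

open Classical in
/-- The splitting field of a finite graph: the subfield of `ℂ` generated over `ℚ` by all complex
roots of the characteristic polynomial of the adjacency matrix. -/
def graphSplittingField {V : Type*} [Fintype V] (Γ : SimpleGraph V) : IntermediateField ℚ ℂ :=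
  IntermediateField.adjoin ℚ {z : ℂ | (Γ.adjMatrix ℂ).charpoly.IsRoot z}

/-- The algebraic degree of a finite graph: the degree over `ℚ` of its splitting field. -/
def algebraicDegree {V : Type*} [Fintype V] (Γ : SimpleGraph V) : ℕ :=
  Module.finrank ℚ (graphSplittingField Γ)

/-- The set of irreducible complex characters of `G`. Every finite-dimensional complex
representation is equivalent to one on some `ℂⁿ`. -/
def Irr (G : Type*) [Group G] : Set (G → ℂ) :=
  {χ | ∃ (n : ℕ) (ρ : Representation ℂ G (Fin n → ℂ)), ρ.IsIrreducible ∧ ρ.character = χ}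

/-- `χ(A) = ∑_{a ∈ A} χ(a)`, counted with multiplicity. -/
def charSum {G : Type*} (χ : G → ℂ) (A : Multiset G) : ℂ := (A.map χ).sum

/-- The multiset `S S⁻¹ = [x y⁻¹ | x ∈ S, y ∈ S]`, with multiplicities. -/
def mulInvMultiset {G : Type*} [Group G] (S : Finset G) : Multiset G :=
  (S.val ×ˢ S.val).map fun p => p.1 * p.2⁻¹

/-- The multiset `X^z = [x^z | x ∈ X]`, with multiplicities. -/
def multisetPow {G : Type*} [Group G] (X : Multiset G) (z : ℕ) : Multiset G :=
  X.map fun x => x ^ z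

theorem multisetPow_mul_units {G : Type*} [Group G] (X : Multiset G)
    (s t : (ZMod (Monoid.exponent G))ˣ) :
    multisetPow X ((s * t : (ZMod (Monoid.exponent G))ˣ) : ZMod (Monoid.exponent G)).val =
      multisetPow (multisetPow X (s : ZMod (Monoid.exponent G)).val)
        (t : ZMod (Monoid.exponent G)).val := by
  simp only [multisetPow, Multiset.map_map, Function.comp_def, ← pow_mul]
  refine Multiset.map_congr rfl fun x _ => ?_
  rw [Units.val_mul, ZMod.val_mul]
  exact (pow_eq_pow_mod _ (Monoid.pow_exponent_eq_one x)).symm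

theorem multisetPow_one_units {G : Type*} [Group G] (X : Multiset G) :
    multisetPow X ((1 : (ZMod (Monoid.exponent G))ˣ) : ZMod (Monoid.exponent G)).val = X := by
  have h : ∀ x : G, x ^ ((1 : (ZMod (Monoid.exponent G))ˣ) : ZMod (Monoid.exponent G)).val = x := by
    intro x
    rw [Units.val_one, ZMod.val_one_eq_one_mod,
      ← pow_eq_pow_mod _ (Monoid.pow_exponent_eq_one x), pow_one]
  exact (Multiset.map_congr rfl fun x _ => h x).trans (Multiset.map_id' X)

/-- For a multiset `X` of elements of a group of exponent `m`, the subgroup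
`{t ∈ (ℤ/mℤ)ˣ | X^t = X}` of `(ℤ/mℤ)ˣ`. -/
def powStabilizer {G : Type*} [Group G] (X : Multiset G) :
    Subgroup (ZMod (Monoid.exponent G))ˣ where
  carrier := {t | multisetPow X (t : ZMod (Monoid.exponent G)).val = X}
  one_mem' := multisetPow_one_units X
  mul_mem' := by
    intro s t hs ht
    change multisetPow X _ = X at hs ht ⊢
    rw [multisetPow_mul_units, hs, ht]
  inv_mem' := by
    intro t ht
    change multisetPow X _ = X at ht ⊢
    have h := multisetPow_mul_units X t t⁻¹
    rw [ht, mul_inv_cancel, multisetPow_one_units] at h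
    exact h.symm

theorem isPrimitiveRoot_gen {m : ℕ} {ω : ℂ} (hω : IsPrimitiveRoot ω m) :
    IsPrimitiveRoot (IntermediateField.AdjoinSimple.gen ℚ ω) m :=
  IsPrimitiveRoot.of_map_of_injective (f := algebraMap ℚ⟮ω⟯ ℂ)
    (by rw [IntermediateField.AdjoinSimple.algebraMap_gen]; exact hω)
    (algebraMap ℚ⟮ω⟯ ℂ).injective

/-- The homomorphism `η : Gal(ℚ(ω)/ℚ) → (ℤ/mℤ)ˣ`, `σ ↦ t` with `σ(ω) = ω ^ t`, where `ω` is a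
primitive `m`-th root of unity. -/
def cyclotomicEta {m : ℕ} [NeZero m] {ω : ℂ} (hω : IsPrimitiveRoot ω m) :
    (ℚ⟮ω⟯ ≃ₐ[ℚ] ℚ⟮ω⟯) →* (ZMod m)ˣ :=
  (isPrimitiveRoot_gen hω).autToPow ℚ

/-- The field `{x ∈ ℚ(ω) | σ x = x for all σ ∈ η⁻¹(T)}`, as a subfield of `ℂ`. -/
def fixedSubfield {m : ℕ} [NeZero m] {ω : ℂ} (hω : IsPrimitiveRoot ω m)
    (T : Subgroup (ZMod m)ˣ) : IntermediateField ℚ ℂ :=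
  IntermediateField.lift (IntermediateField.fixedField (T.comap (cyclotomicEta hω)))

/-- The subgroup of `Kˣ / (Kˣ)²` generated by the classes `[a]_K` of the nonzero elements
`a ∈ K` that lie in `A`. -/
def squareClassSubgroup (K : IntermediateField ℚ ℂ) (A : Set ℂ) :
    Subgroup (Kˣ ⧸ (powMonoidHom 2 : Kˣ →* Kˣ).range) :=
  Subgroup.closure {c | ∃ u : Kˣ, ((u : K) : ℂ) ∈ A ∧ c = QuotientGroup.mk u}

end

/-! Let `a` be the sum of `S` in `ℂ[G]` and `a'` the sum of the inverses. Since `S` is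
conjugate-closed, both are central. The adjacency matrix is block antidiagonal, its blocks being
left multiplication by `a'` and by `a`, so `z` is an eigenvalue exactly when `z²` lies in the
spectrum of `a * a'`, the sum of `S S⁻¹`. By Schur's lemma this element acts on an irreducible
representation of dimension `n` and character `χ` as the scalar `|χ(S)|² / n²`, and by Maschke's
theorem its spectrum consists of these scalars (`mem_spectrum_iff_of_central`). Hence the
eigenvalues are `±|χ(S)| / n`, and the splitting field is generated over `ℚ` by the numbers
`|χ(S)|`.

The trace of the same scalar gives `χ(S S⁻¹) = |χ(S)|² / n`. A Galois automorphism of `ℚ(ω)` with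
`η(σ) = t` sends `χ(X)` to `χ(X^t)`, and irreducible characters separate conjugation-invariant
multisets. So `σ` fixes every `χ(S S⁻¹)` exactly when `t ∈ T`, and by Galois theory `K` is generated
by these values (`fixedSubfield_powStabilizer`), hence by the `|χ(S)|²`.

The splitting field is thus obtained from `K` by adjoining square roots of elements of `K`. Kummer
theory for exponent two (`finrank_eq_card_squareClasses`) gives degree `|M|` over `K`, and `K` has
degree `φ(m) / |T|` over `ℚ`. -/

/-! ### Irreducible representations and central elements of the group algebra -/

/-- A central element of the group algebra acts on an irreducible representation as a scalar. -/
theorem Representation.IsIrreducible.exists_asAlgebraHom_eq_smul_one {G : Type*} [Group G] {n : ℕ}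
    (ρ : Representation ℂ G (Fin n → ℂ)) [ρ.IsIrreducible] {a : MonoidAlgebra ℂ G}
    (ha : ∀ b, a * b = b * a) : ∃ c : ℂ, ρ.asAlgebraHom a = c • 1 := by
  obtain ⟨c, hc⟩ := (Representation.IsIrreducible.algebraMap_intertwiningMap_bijective_of_isAlgClosed
    (ρ := ρ)).2 ((ρ.asAlgebraHom a).intertwiningMap_of_isIntertwiningMap ρ ρ fun g v => by
      rw [← Representation.asAlgebraHom_single_one, ← Module.End.mul_apply, ← map_mul, ha, map_mul,
        Module.End.mul_apply])
  refine ⟨c, LinearMap.ext fun v => ?_⟩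
  have := congrArg (fun f : Representation.IntertwiningMap ρ ρ => f v) hc
  exact this.symm

/-- Every irreducible representation has positive dimension. -/
theorem Representation.IsIrreducible.dim_ne_zero {G : Type*} [Group G] {n : ℕ}
    (ρ : Representation ℂ G (Fin n → ℂ)) [ρ.IsIrreducible] : n ≠ 0 := by
  rintro rfl
  have := IsSimpleModule.nontrivial (MonoidAlgebra ℂ G) ρ.asModule
  obtain ⟨v, hv⟩ := exists_ne (0 : ρ.asModule)
  exact hv (Subsingleton.elim (α := Fin 0 → ℂ) _ _)

/-- The scalar by which a central element acts is its trace divided by the dimension. -/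
theorem Representation.IsIrreducible.asAlgebraHom_eq_trace_div {G : Type*} [Group G] {n : ℕ}
    (ρ : Representation ℂ G (Fin n → ℂ)) [ρ.IsIrreducible] {a : MonoidAlgebra ℂ G}
    (ha : ∀ b, a * b = b * a) :
    ρ.asAlgebraHom a = (LinearMap.trace ℂ _ (ρ.asAlgebraHom a) / n) • 1 := by
  obtain ⟨c, hc⟩ := exists_asAlgebraHom_eq_smul_one ρ ha
  have hn : (n : ℂ) ≠ 0 := Nat.cast_ne_zero.2 (dim_ne_zero ρ)
  rw [hc, map_smul, LinearMap.trace_one]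
  simp [hn]

/-- The quotient of the group algebra of a finite group by a maximal left ideal gives an irreducible
representation on some `ℂⁿ`. -/
theorem exists_irreducible_of_isMaximal {G : Type*} [Group G] [Finite G]
    (I : Ideal (MonoidAlgebra ℂ G)) [I.IsMaximal] :
    ∃ (n : ℕ) (ρ : Representation ℂ G (Fin n → ℂ)), ρ.IsIrreducible ∧
      ∀ a, ρ.asAlgebraHom a = 0 ↔ ∀ b, a * b ∈ I := by
  let M := MonoidAlgebra ℂ G ⧸ I
  have : Module.Finite ℂ (MonoidAlgebra ℂ G) := .of_basis (MonoidAlgebra.basis G ℂ)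
  have : Module.Finite ℂ M := .of_surjective ((Submodule.mkQ I).restrictScalars ℂ)
    (Submodule.mkQ_surjective I)
  let e : M ≃ₗ[ℂ] (Fin (Module.finrank ℂ M) → ℂ) := (Module.finBasis ℂ M).equivFun
  let φ : MonoidAlgebra ℂ G →ₐ[ℂ] Module.End ℂ (Fin (Module.finrank ℂ M) → ℂ) :=
    (e.conjAlgEquiv ℂ).toAlgHom.comp (Algebra.lsmul ℂ ℂ M)
  let ρ : Representation ℂ G (Fin (Module.finrank ℂ M) → ℂ) :=
    (MonoidAlgebra.lift ℂ _ G).symm φ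
  have hρ : ρ.asAlgebraHom = φ := (MonoidAlgebra.lift ℂ _ G).apply_symm_apply φ
  have hφ : ∀ a v, φ a v = e (a • e.symm v) := fun a v => rfl
  refine ⟨_, ρ, ?_, fun a => ?_⟩
  · rw [Representation.irreducible_iff_isSimpleModule_asModule]
    have hM : IsSimpleModule (MonoidAlgebra ℂ G) M := isSimpleModule_iff_isCoatom.2 ‹I.IsMaximal›.1
    let E : ρ.asModule ≃ₗ[MonoidAlgebra ℂ G] M :=
      { ρ.asModuleEquiv.trans e.symm with
        map_smul' := fun a x => by
          change e.symm (ρ.asModuleEquiv (a • x)) = a • e.symm (ρ.asModuleEquiv x)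
          rw [Representation.asModuleEquiv_map_smul, hρ, hφ, e.symm_apply_apply] }
    exact IsSimpleModule.congr E
  · rw [hρ]
    constructor
    · intro h b
      have := hφ a (e (Submodule.Quotient.mk b))
      rw [h, LinearMap.zero_apply, e.symm_apply_apply, eq_comm, e.map_eq_zero_iff,
        ← Submodule.Quotient.mk_smul] at this
      exact (Submodule.Quotient.mk_eq_zero I).1 this
    · intro h
      refine LinearMap.ext fun v => ?_
      obtain ⟨b, hb⟩ := Submodule.Quotient.mk_surjective I (e.symm v)
      rw [hφ, ← hb, ← Submodule.Quotient.mk_smul, LinearMap.zero_apply, e.map_eq_zero_iff]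
      exact (Submodule.Quotient.mk_eq_zero I).2 (h b)

/-- An element of the group algebra of a finite group that acts as zero on every irreducible
representation vanishes. -/
theorem eq_zero_of_asAlgebraHom_eq_zero {G : Type*} [Group G] [Finite G] {a : MonoidAlgebra ℂ G}
    (h : ∀ (n : ℕ) (ρ : Representation ℂ G (Fin n → ℂ)), ρ.IsIrreducible → ρ.asAlgebraHom a = 0) :
    a = 0 := by
  -- Invertibility of `|G|` in `ℂ` is the hypothesis of Maschke's theorem, which makes the group
  -- algebra semisimple.
  have : NeZero (Nat.card G : ℂ) := ⟨Nat.cast_ne_zero.2 Nat.card_pos.ne'⟩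
  have hJ : Ring.jacobson (MonoidAlgebra ℂ G) = ⊥ := IsSemisimpleRing.jacobson_eq_bot _
  rw [← Submodule.mem_bot (MonoidAlgebra ℂ G), ← hJ, Ring.jacobson_eq_sInf_isMaximal,
    Submodule.mem_sInf]
  intro I hI
  have : Ideal.IsMaximal I := hI
  obtain ⟨n, ρ, hρ, hρI⟩ := exists_irreducible_of_isMaximal I
  simpa using (hρI a).1 (h n ρ hρ) 1

/-- The spectrum of a central element of the group algebra consists of the scalars by which it acts
on the irreducible representations. -/
theorem mem_spectrum_iff_of_central {G : Type*} [Group G] [Finite G] {a : MonoidAlgebra ℂ G}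
    (ha : ∀ b, a * b = b * a) (z : ℂ) :
    z ∈ spectrum ℂ a ↔ ∃ (n : ℕ) (ρ : Representation ℂ G (Fin n → ℂ)), ρ.IsIrreducible ∧
      z = LinearMap.trace ℂ _ (ρ.asAlgebraHom a) / n := by
  have hc : ∀ b, (algebraMap ℂ _ z - a) * b = b * (algebraMap ℂ _ z - a) := fun b => by
    rw [sub_mul, mul_sub, ha, Algebra.commutes]
  have key : ∀ (n : ℕ) (ρ : Representation ℂ G (Fin n → ℂ)), ρ.IsIrreducible →
      (z = LinearMap.trace ℂ _ (ρ.asAlgebraHom a) / n ↔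
        ρ.asAlgebraHom (algebraMap ℂ _ z - a) = 0) := by
    intro n ρ hρ
    have hn : n ≠ 0 := Representation.IsIrreducible.dim_ne_zero ρ
    have : NeZero n := ⟨hn⟩
    have h1 : (1 : Module.End ℂ (Fin n → ℂ)) ≠ 0 := one_ne_zero
    rw [map_sub, AlgHom.commutes, Representation.IsIrreducible.asAlgebraHom_eq_trace_div ρ ha,
      Algebra.algebraMap_eq_smul_one, ← sub_smul, smul_eq_zero, or_iff_left h1, sub_eq_zero,
      ← Representation.IsIrreducible.asAlgebraHom_eq_trace_div ρ ha]
  rw [spectrum.mem_iff]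
  constructor
  · intro h
    -- By centrality a left inverse is two-sided, so a central non-unit generates a proper left
    -- ideal.
    have hI : Ideal.span {algebraMap ℂ _ z - a} ≠ ⊤ := by
      intro htop
      rw [Ideal.eq_top_iff_one, Ideal.mem_span_singleton'] at htop
      obtain ⟨b, hb⟩ := htop
      exact h ⟨⟨_, b, by rw [hc, hb], hb⟩, rfl⟩
    obtain ⟨I, hI, hle⟩ := Ideal.exists_le_maximal _ hI
    obtain ⟨n, ρ, hρ, hρI⟩ := exists_irreducible_of_isMaximal I
    refine ⟨n, ρ, hρ, (key n ρ hρ).2 ((hρI _).2 fun b => ?_)⟩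
    rw [hc]
    exact I.mul_mem_left b (hle (Ideal.mem_span_singleton_self _))
  · rintro ⟨n, ρ, hρ, hz⟩ hu
    have : NeZero n := ⟨Representation.IsIrreducible.dim_ne_zero ρ⟩
    have := hu.map ρ.asAlgebraHom
    rw [(key n ρ hρ).1 hz] at this
    exact not_isUnit_zero this

/-! ### Character values as sums of roots of unity -/

/-- The traces of the powers of an endomorphism of finite order are power sums of roots of unity. -/
theorem exists_trace_pow_eq_sum {n m : ℕ} (hm : m ≠ 0) (f : Module.End ℂ (Fin n → ℂ))
    (hf : f ^ m = 1) :
    ∃ (ι : Type) (_ : Fintype ι) (d : ι → ℕ) (μ : ι → ℂ), (∀ i, μ i ^ m = 1) ∧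
      ∀ k : ℕ, LinearMap.trace ℂ _ (f ^ k) = ∑ i, d i * μ i ^ k := by
  classical
  have hss : f.IsSemisimple := by
    refine Module.End.isSemisimple_of_squarefree_aeval_eq_zero (p := Polynomial.X ^ m - 1) ?_ ?_
    · exact ((Polynomial.X_pow_sub_one_separable_iff).2 (Nat.cast_ne_zero.2 hm)).squarefree
    · simp [hf]
  have htop : ⨆ μ, f.eigenspace μ = ⊤ := by
    rw [← Module.End.iSup_maxGenEigenspace_eq_top f]
    exact iSup_congr fun μ => (hss.isFinitelySemisimple.maxGenEigenspace_eq_eigenspace μ).symm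
  have hint : DirectSum.IsInternal fun μ : f.Eigenvalues => f.eigenspace μ := by
    refine DirectSum.isInternal_submodule_of_iSupIndep_of_iSup_eq_top
      (f.eigenspaces_iSupIndep.comp Subtype.val_injective) ?_
    rw [eq_top_iff, ← htop]
    refine iSup_le fun μ => ?_
    by_cases h : f.HasEigenvalue μ
    · exact le_iSup (fun μ : f.Eigenvalues => f.eigenspace μ) ⟨μ, h⟩
    · exact (not_not.1 h).le.trans bot_le
  have hpow : ∀ (μ : ℂ) (k : ℕ), ∀ v ∈ f.eigenspace μ, (f ^ k) v = μ ^ k • v := by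
    intro μ k v hv
    induction k with
    | zero => simp
    | succ k ih =>
      rw [pow_succ, Module.End.mul_apply, Module.End.mem_eigenspace_iff.1 hv, map_smul, ih, smul_smul,
        pow_succ, mul_comm]
  refine ⟨f.Eigenvalues, inferInstance, fun μ => Module.finrank ℂ (f.eigenspace μ), fun μ => μ,
    fun μ => ?_, fun k => ?_⟩
  · obtain ⟨v, hv⟩ := Module.End.HasEigenvalue.exists_hasEigenvector (f := f) (μ := μ) μ.2
    have := hpow μ m v hv.1
    rw [hf, Module.End.one_apply] at this
    exact (smul_left_injective ℂ hv.2 (by simpa using this)).symm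
  · have hmaps : ∀ μ : f.Eigenvalues, Set.MapsTo (f ^ k) (f.eigenspace μ) (f.eigenspace μ) :=
      fun μ v hv => by
        rw [SetLike.mem_coe, hpow μ k v hv]; exact Submodule.smul_mem _ _ hv
    rw [LinearMap.trace_eq_sum_trace_restrict hint hmaps]
    refine Finset.sum_congr rfl fun μ _ => ?_
    have : (f ^ k).restrict (hmaps μ) = (μ : ℂ) ^ k • 1 :=
      LinearMap.ext fun v => Subtype.ext (hpow μ k v v.2)
    rw [this, map_smul, LinearMap.trace_one, smul_eq_mul, mul_comm]

/-- The values of a character on the powers of a group element are power sums of roots of unity. -/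
theorem exists_character_pow_eq_sum {G : Type*} [Group G] [Finite G] {n : ℕ}
    (ρ : Representation ℂ G (Fin n → ℂ)) (g : G) :
    ∃ (ι : Type) (_ : Fintype ι) (d : ι → ℕ) (μ : ι → ℂ), (∀ i, μ i ^ Monoid.exponent G = 1) ∧
      ∀ k : ℕ, ρ.character (g ^ k) = ∑ i, d i * μ i ^ k := by
  obtain ⟨ι, hι, d, μ, hμ, h⟩ := exists_trace_pow_eq_sum
    (Monoid.exponent_ne_zero_of_finite (G := G)) (ρ g)
    (by rw [← map_pow, Monoid.pow_exponent_eq_one, map_one])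
  exact ⟨ι, hι, d, μ, hμ, fun k => by rw [← h, ← map_pow]; rfl⟩

/-- A character of a finite group takes complex conjugate values at inverse elements. -/
theorem character_inv {G : Type*} [Group G] [Finite G] {n : ℕ}
    (ρ : Representation ℂ G (Fin n → ℂ)) (g : G) :
    ρ.character g⁻¹ = starRingEnd ℂ (ρ.character g) := by
  have hm : 0 < Monoid.exponent G := Monoid.exponent_pos.2 (Monoid.ExponentExists.of_finite)
  obtain ⟨ι, hι, d, μ, hμ, h⟩ := exists_character_pow_eq_sum ρ g
  have hg : g⁻¹ = g ^ (Monoid.exponent G - 1) := by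
    rw [inv_eq_iff_mul_eq_one, ← pow_succ', Nat.sub_add_cancel hm, Monoid.pow_exponent_eq_one]
  have h1 := h 1
  rw [pow_one] at h1
  rw [hg, h, h1, map_sum]
  refine Finset.sum_congr rfl fun i _ => ?_
  have hn : ‖μ i‖ = 1 := Complex.norm_eq_one_of_pow_eq_one (hμ i) hm.ne'
  rw [map_mul, pow_one, Complex.conj_natCast, ← Complex.inv_eq_conj hn]
  congr 1
  refine eq_inv_of_mul_eq_one_left ?_
  rw [← pow_succ, Nat.sub_add_cancel hm, hμ]

/-! ### Multisets as elements of the group algebra -/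

/-- The sum of the elements of a multiset, in the group algebra. -/
noncomputable def groupAlgebraSum {G : Type*} [Group G] (X : Multiset G) : MonoidAlgebra ℂ G :=
  (X.map (MonoidAlgebra.of ℂ G)).sum

theorem groupAlgebraSum_coeff {G : Type*} [Group G] [DecidableEq G] (X : Multiset G) (g : G) :
    (groupAlgebraSum X).coeff g = X.count g := by
  induction X using Multiset.induction_on with
  | empty => simp [groupAlgebraSum]
  | cons x X ih =>
    rw [groupAlgebraSum] at ih ⊢
    rw [Multiset.map_cons, Multiset.sum_cons, MonoidAlgebra.coeff_add, Finsupp.add_apply, ih,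
      Multiset.count_cons]
    by_cases h : g = x <;> simp [h, add_comm]

/-- Coefficients are multiplicities, and `ℂ` has characteristic zero. Equalities of multisets can
therefore be checked in the group algebra. -/
theorem groupAlgebraSum_injective {G : Type*} [Group G] :
    Function.Injective (groupAlgebraSum : Multiset G → MonoidAlgebra ℂ G) := by
  classical
  intro X Y h
  refine Multiset.ext.2 fun g => ?_
  have := congrArg (fun a : MonoidAlgebra ℂ G => a.coeff g) h
  simpa only [groupAlgebraSum_coeff, Nat.cast_inj] using this

/-- Conjugation by `g` only permutes `X`, so the sum commutes with each group element, and these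
span the algebra. -/
theorem groupAlgebraSum_central {G : Type*} [Group G] {X : Multiset G}
    (hX : ∀ g : G, X.map (fun x => g * x * g⁻¹) = X) (b : MonoidAlgebra ℂ G) :
    groupAlgebraSum X * b = b * groupAlgebraSum X := by
  induction b using MonoidAlgebra.induction_on with
  | of g =>
    conv_lhs => rw [← hX g]
    simp only [groupAlgebraSum, Multiset.map_map, ← Multiset.sum_map_mul_left,
      ← Multiset.sum_map_mul_right, Function.comp_def, ← map_mul, inv_mul_cancel_right]
  | add a b ha hb => rw [mul_add, add_mul, ha, hb]
  | smul r a ha => rw [mul_smul_comm, smul_mul_assoc, ha]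

theorem trace_groupAlgebraSum {G : Type*} [Group G] {n : ℕ}
    (ρ : Representation ℂ G (Fin n → ℂ)) (X : Multiset G) :
    LinearMap.trace ℂ _ (ρ.asAlgebraHom (groupAlgebraSum X)) = charSum ρ.character X := by
  rw [groupAlgebraSum, charSum, map_multiset_sum, map_multiset_sum, Multiset.map_map,
    Multiset.map_map]
  refine congrArg _ (Multiset.map_congr rfl fun x _ => ?_)
  simp [Representation.character]

theorem charSum_inv {G : Type*} [Group G] [Finite G] {n : ℕ}
    (ρ : Representation ℂ G (Fin n → ℂ)) (X : Multiset G) :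
    charSum ρ.character (X.map (·⁻¹)) = starRingEnd ℂ (charSum ρ.character X) := by
  rw [charSum, charSum, map_multiset_sum, Multiset.map_map, Multiset.map_map]
  exact congrArg _ (Multiset.map_congr rfl fun x _ => character_inv ρ x)

theorem groupAlgebraSum_mulInvMultiset {G : Type*} [Group G] (S : Finset G) :
    groupAlgebraSum (mulInvMultiset S) =
      groupAlgebraSum S.val * groupAlgebraSum (S.val.map (·⁻¹)) := by
  have h1 : groupAlgebraSum S.val = ∑ s ∈ S, MonoidAlgebra.of ℂ G s := rfl
  have h2 : groupAlgebraSum (S.val.map (·⁻¹)) = ∑ s ∈ S, MonoidAlgebra.of ℂ G s⁻¹ := by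
    rw [groupAlgebraSum, Multiset.map_map]; rfl
  have h3 : groupAlgebraSum (mulInvMultiset S) =
      ∑ p ∈ S ×ˢ S, MonoidAlgebra.of ℂ G (p.1 * p.2⁻¹) := by
    rw [groupAlgebraSum, mulInvMultiset, Multiset.map_map]; rfl
  rw [h1, h2, h3, Finset.sum_mul_sum, Finset.sum_product]
  simp only [map_mul]

theorem ConjugateClosed.map_conj {G : Type*} [Group G] {S : Finset G} (hS : ConjugateClosed S)
    (g : G) : S.val.map (fun x => g * x * g⁻¹) = S.val := by
  classical
  have hinj : Function.Injective fun x : G => g * x * g⁻¹ := (MulAut.conj g).injective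
  have : S.map ⟨_, hinj⟩ = S := by
    refine Finset.eq_of_subset_of_card_le (fun y hy => ?_) (Finset.card_map _).ge
    obtain ⟨x, hx, rfl⟩ := Finset.mem_map.1 hy
    simpa using hS x hx g⁻¹
  exact congrArg Finset.val this

theorem map_inv_conj {G : Type*} [Group G] {X : Multiset G}
    (hX : ∀ g : G, X.map (fun x => g * x * g⁻¹) = X) (g : G) :
    (X.map (·⁻¹)).map (fun x => g * x * g⁻¹) = X.map (·⁻¹) := by
  conv_rhs => rw [← hX g]
  simp only [Multiset.map_map, Function.comp_def, mul_inv_rev, inv_inv, mul_assoc]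

theorem multisetPow_conj {G : Type*} [Group G] {X : Multiset G}
    (hX : ∀ g : G, X.map (fun x => g * x * g⁻¹) = X) (k : ℕ) (g : G) :
    (multisetPow X k).map (fun x => g * x * g⁻¹) = multisetPow X k := by
  conv_rhs => rw [← hX g]
  simp only [multisetPow, Multiset.map_map, Function.comp_def, conj_pow]

/-- In the group algebra `S S⁻¹` becomes a product of two central elements, which conjugation by `g`
fixes; injectivity carries this back to multisets. -/
theorem ConjugateClosed.mulInvMultiset_conj {G : Type*} [Group G] {S : Finset G}
    (hS : ConjugateClosed S) (g : G) :
    (mulInvMultiset S).map (fun x => g * x * g⁻¹) = mulInvMultiset S := by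
  apply groupAlgebraSum_injective
  have h := groupAlgebraSum_central hS.map_conj (MonoidAlgebra.of ℂ G g)
  have h' := groupAlgebraSum_central (map_inv_conj hS.map_conj) (MonoidAlgebra.of ℂ G g)
  have hc : groupAlgebraSum (mulInvMultiset S) * MonoidAlgebra.of ℂ G g =
      MonoidAlgebra.of ℂ G g * groupAlgebraSum (mulInvMultiset S) := by
    rw [groupAlgebraSum_mulInvMultiset, mul_assoc, h', ← mul_assoc, h, mul_assoc]
  have hmap : groupAlgebraSum ((mulInvMultiset S).map fun x => g * x * g⁻¹) =
      MonoidAlgebra.of ℂ G g * groupAlgebraSum (mulInvMultiset S) * MonoidAlgebra.of ℂ G g⁻¹ := by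
    simp only [groupAlgebraSum, Multiset.map_map, ← Multiset.sum_map_mul_left,
      ← Multiset.sum_map_mul_right, Function.comp_def, map_mul]
  rw [hmap, ← hc, mul_assoc, ← map_mul, mul_inv_cancel, map_one, mul_one]

/-- Conjugation invariant multisets are separated by the irreducible characters. -/
theorem eq_of_charSum_eq {G : Type*} [Group G] [Finite G] {X Y : Multiset G}
    (hX : ∀ g : G, X.map (fun x => g * x * g⁻¹) = X)
    (hY : ∀ g : G, Y.map (fun x => g * x * g⁻¹) = Y)
    (h : ∀ χ ∈ Irr G, charSum χ X = charSum χ Y) : X = Y := by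
  apply groupAlgebraSum_injective
  rw [← sub_eq_zero]
  refine eq_zero_of_asAlgebraHom_eq_zero fun n ρ hρ => ?_
  rw [Representation.IsIrreducible.asAlgebraHom_eq_trace_div ρ fun b => by
    rw [sub_mul, mul_sub, groupAlgebraSum_central hX, groupAlgebraSum_central hY],
    map_sub, map_sub, trace_groupAlgebraSum, trace_groupAlgebraSum, h _ ⟨n, ρ, hρ, rfl⟩, sub_self,
    zero_div, zero_smul]

/-- `χ(S S⁻¹) = |χ(S)|² / χ(1)`. -/
theorem charSum_mulInvMultiset {G : Type*} [Group G] [Finite G] {S : Finset G}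
    (hS : ConjugateClosed S) {n : ℕ} (ρ : Representation ℂ G (Fin n → ℂ)) [ρ.IsIrreducible] :
    charSum ρ.character (mulInvMultiset S) = ((‖charSum ρ.character S.val‖ ^ 2 : ℝ) : ℂ) / n := by
  have hn : (n : ℂ) ≠ 0 := Nat.cast_ne_zero.2 (Representation.IsIrreducible.dim_ne_zero ρ)
  rw [← trace_groupAlgebraSum, groupAlgebraSum_mulInvMultiset, map_mul,
    Representation.IsIrreducible.asAlgebraHom_eq_trace_div ρ
      (groupAlgebraSum_central hS.map_conj),
    Representation.IsIrreducible.asAlgebraHom_eq_trace_div ρ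
      (groupAlgebraSum_central (map_inv_conj hS.map_conj)),
    trace_groupAlgebraSum, trace_groupAlgebraSum, charSum_inv, smul_mul_smul_comm, mul_one,
    map_smul, LinearMap.trace_one, div_mul_div_comm, Complex.mul_conj, Complex.normSq_eq_norm_sq]
  rw [smul_eq_mul, Module.finrank_fin_fun]
  field_simp

theorem central_mulInv {G : Type*} [Group G] {S : Finset G} (hS : ConjugateClosed S) :
    ∀ b, groupAlgebraSum (mulInvMultiset S) * b = b * groupAlgebraSum (mulInvMultiset S) :=
  groupAlgebraSum_central hS.mulInvMultiset_conj

theorem mem_spectrum_mulInvMultiset_iff {G : Type*} [Group G] [Finite G] {S : Finset G}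
    (hS : ConjugateClosed S) (z : ℂ) :
    z ∈ spectrum ℂ (groupAlgebraSum (mulInvMultiset S)) ↔
      ∃ (n : ℕ) (ρ : Representation ℂ G (Fin n → ℂ)), ρ.IsIrreducible ∧
        z = (((‖charSum ρ.character S.val‖ / n) ^ 2 : ℝ) : ℂ) := by
  rw [mem_spectrum_iff_of_central (central_mulInv hS)]
  refine exists_congr fun n => exists_congr fun ρ => and_congr_right fun hρ => ?_
  rw [trace_groupAlgebraSum, charSum_mulInvMultiset hS ρ]
  push_cast
  rw [div_pow, div_div, sq (n : ℂ)]

/-! ### Kummer theory for square roots -/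

/-- If `x² = u`, `y² = v` with `u, v` in the same
square class of the base field, then `x` is a multiple of `y` by an element of the base field. -/
theorem exists_eq_algebraMap_mul_of_squareClass_eq {F L : Type*} [Field F] [Field L] [Algebra F L]
    {x y : L} {u v : Fˣ} (hx : x ^ 2 = algebraMap F L u) (hy : y ^ 2 = algebraMap F L v)
    (h : (QuotientGroup.mk u : Fˣ ⧸ (powMonoidHom 2 : Fˣ →* Fˣ).range) = QuotientGroup.mk v) :
    ∃ f : F, x = algebraMap F L f * y := by
  obtain ⟨w, hw⟩ := QuotientGroup.eq.1 h.symm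
  have hu : u = v * w ^ 2 := by
    rw [← powMonoidHom_apply, hw, mul_inv_cancel_left]
  have : x ^ 2 = (algebraMap F L w * y) ^ 2 := by
    rw [hx, hu, mul_pow, hy, Units.val_mul, Units.val_pow_eq_pow_val, map_mul, map_pow, mul_comm]
  rcases sq_eq_sq_iff_eq_or_eq_neg.1 this with h | h
  · exact ⟨w, h⟩
  · exact ⟨-w, by rw [h, map_neg, neg_mul]⟩

/-- Kummer theory for exponent two: the degree of a finite Galois extension generated by square
roots is the order of the group generated by the square classes. -/
theorem finrank_eq_card_squareClasses {F L : Type*} [Field F] [Field L] [Algebra F L]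
    [FiniteDimensional F L] [IsGalois F L] (Z : Set L) (hZ : IntermediateField.adjoin F Z = ⊤)
    (hsq : ∀ z ∈ Z, ∃ f : F, algebraMap F L f = z ^ 2) :
    Module.finrank F L = Nat.card (Subgroup.closure
      {c : Fˣ ⧸ (powMonoidHom 2 : Fˣ →* Fˣ).range |
        ∃ u : Fˣ, (∃ z ∈ Z, algebraMap F L u = z ^ 2) ∧ c = QuotientGroup.mk u}) := by
  classical
  set M := Subgroup.closure {c : Fˣ ⧸ (powMonoidHom 2 : Fˣ →* Fˣ).range |
        ∃ u : Fˣ, (∃ z ∈ Z, algebraMap F L u = z ^ 2) ∧ c = QuotientGroup.mk u} with hM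
  -- Products and inverses of square roots are square roots, so every class of `M`, not just each
  -- generator, has a representative with a root in `L`.
  have hroot : ∀ c : M, ∃ (x : L) (u : Fˣ), QuotientGroup.mk u = (c : Fˣ ⧸ (powMonoidHom 2 : Fˣ →* Fˣ).range) ∧
      x ^ 2 = algebraMap F L u := by
    rintro ⟨c, hc⟩
    induction hc using Subgroup.closure_induction with
    | mem c h => obtain ⟨u, ⟨z, -, hz⟩, rfl⟩ := h; exact ⟨z, u, rfl, hz.symm⟩
    | one => exact ⟨1, 1, rfl, by simp⟩
    | mul a b _ _ ha hb =>
      obtain ⟨x, u, hu, hx⟩ := ha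
      obtain ⟨y, v, hv, hy⟩ := hb
      simp only at hu hv
      exact ⟨x * y, u * v, congrArg₂ (· * ·) hu hv, by rw [mul_pow, hx, hy]; simp⟩
    | inv a _ ha =>
      obtain ⟨x, u, hu, hx⟩ := ha
      simp only at hu
      exact ⟨x⁻¹, u⁻¹, congrArg (·⁻¹) hu, by rw [inv_pow, hx]; simp⟩
  choose r u hu hr using hroot
  have hr0 : ∀ c, r c ≠ 0 := fun c h => by
    have := hr c
    rw [h, zero_pow two_ne_zero, eq_comm, map_eq_zero] at this
    exact (u c).ne_zero this
  -- the pairing between the Galois group and the group of square classes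
  let χ : Gal(L/F) → M → L := fun σ c => σ (r c) / r c
  have hfix : ∀ (f : F) (σ : Gal(L/F)) (x : L), x ≠ 0 → f ≠ 0 →
      σ (algebraMap F L f * x) / (algebraMap F L f * x) = σ x / x := by
    intro f σ x hx hf
    rw [map_mul, AlgEquiv.commutes, mul_div_mul_left _ _ ((map_ne_zero _).2 hf)]
  -- The sign `σ x / x` depends only on the square class, since two admissible roots differ by a
  -- factor in `F`. This makes the pairing multiplicative in both variables.
  have hχ : ∀ (σ : Gal(L/F)) (c : M) (x : L) (v : Fˣ), x ^ 2 = algebraMap F L v →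
      QuotientGroup.mk v = (c : Fˣ ⧸ (powMonoidHom 2 : Fˣ →* Fˣ).range) → σ x / x = χ σ c := by
    intro σ c x v hx hv
    have hx0 : x ≠ 0 := fun h => by
      rw [h, zero_pow two_ne_zero, eq_comm, map_eq_zero] at hx
      exact v.ne_zero hx
    obtain ⟨f, hf⟩ := exists_eq_algebraMap_mul_of_squareClass_eq hx (hr c) (hv.trans (hu c).symm)
    have hf0 : f ≠ 0 := by rintro rfl; exact hx0 (by simpa using hf)
    rw [hf, hfix f σ _ (hr0 c) hf0]
  have hmulM : ∀ σ c d, χ σ (c * d) = χ σ c * χ σ d := by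
    intro σ c d
    rw [← hχ σ (c * d) (r c * r d) (u c * u d) (by rw [mul_pow, hr, hr]; simp)
      (by rw [QuotientGroup.mk_mul, hu, hu]; rfl), map_mul, mul_div_mul_comm]
  have honeM : ∀ σ, χ σ 1 = 1 := by
    intro σ
    rw [← hχ σ 1 1 1 (by simp) rfl, map_one, div_one]
  have hmulG : ∀ σ τ c, χ (σ * τ) c = χ σ c * χ τ c := by
    intro σ τ c
    have h1 : τ (r c) ^ 2 = algebraMap F L (u c) := by rw [← map_pow, hr, AlgEquiv.commutes]
    have h2 : τ (r c) ≠ 0 := (map_ne_zero τ).2 (hr0 c)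
    have := hχ σ c _ _ h1 (hu c)
    rw [← this]
    simp only [χ, AlgEquiv.mul_apply]
    field_simp [hr0 c]
  have honeG : ∀ c, χ 1 c = 1 := fun c => div_self (hr0 c)
  let φG : Gal(L/F) → (M →* L) := fun σ => ⟨⟨χ σ, honeM σ⟩, hmulM σ⟩
  let φM : M → (Gal(L/F) →* L) := fun c => ⟨⟨fun σ => χ σ c, honeG c⟩, fun σ τ => hmulG σ τ c⟩
  -- If two classes pair equally with all of the Galois group, the quotient of their roots is fixed,
  -- hence lies in `F`, and the classes agree.
  have hφM : Function.Injective φM := by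
    intro c d hcd
    have hq : ∀ σ : Gal(L/F), σ (r c / r d) = r c / r d := by
      intro σ
      have : σ (r c) / r c = σ (r d) / r d := DFunLike.congr_fun hcd σ
      rw [map_div₀, div_eq_div_iff ((map_ne_zero σ).2 (hr0 d)) (hr0 d)]
      rw [div_eq_div_iff (hr0 c) (hr0 d)] at this
      rw [this, mul_comm]
    obtain ⟨f, hf⟩ := (IsGalois.mem_range_algebraMap_iff_fixed (F := F) (r c / r d)).2 hq
    have hf0 : f ≠ 0 := by
      rintro rfl
      rw [map_zero, eq_comm] at hf
      exact div_ne_zero (hr0 c) (hr0 d) hf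
    have huv : u c = u d * (Units.mk0 f hf0) ^ 2 := by
      apply Units.ext
      apply (algebraMap F L).injective
      rw [Units.val_mul, Units.val_pow_eq_pow_val, map_mul, map_pow, Units.val_mk0, hf, ← hr, ← hr, div_pow,
        mul_div_cancel₀ _ (pow_ne_zero 2 (hr0 d))]
    apply Subtype.ext
    rw [← hu c, ← hu d, huv, eq_comm, QuotientGroup.eq]
    exact ⟨Units.mk0 f hf0, by simp⟩
  have hφG : Function.Injective φG := by
    intro σ τ h
    have hστ : ∀ x ∈ IntermediateField.adjoin F Z, σ x = τ x := by
      intro x hx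
      induction hx using IntermediateField.adjoin_induction with
      | mem z hz =>
        -- A zero generator has no square class, but both automorphisms fix it.
        by_cases hz0 : z = 0
        · rw [hz0, map_zero, map_zero]
        obtain ⟨f, hf⟩ := hsq z hz
        have hf0 : f ≠ 0 := by
          rintro rfl
          rw [map_zero] at hf
          exact pow_ne_zero 2 hz0 hf.symm
        let c : M := ⟨QuotientGroup.mk (Units.mk0 f hf0),
          Subgroup.subset_closure ⟨Units.mk0 f hf0, ⟨z, hz, hf⟩, rfl⟩⟩
        have h1 := hχ σ c z (Units.mk0 f hf0) hf.symm rfl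
        have h2 := hχ τ c z (Units.mk0 f hf0) hf.symm rfl
        have h3 : χ σ c = χ τ c := DFunLike.congr_fun h c
        rw [← h1, ← h2] at h3
        exact (div_left_inj' hz0).1 h3
      | algebraMap f => rw [AlgEquiv.commutes, AlgEquiv.commutes]
      | add x y _ _ hx hy => rw [map_add, map_add, hx, hy]
      | inv x _ hx => rw [map_inv₀, map_inv₀, hx]
      | mul x y _ _ hx hy => rw [map_mul, map_mul, hx, hy]
    exact AlgEquiv.ext fun x => hστ x (by rw [hZ]; trivial)
  -- Dedekind's independence of characters, applied on both sides of the pairing, gives `|M| ≤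
  -- |Gal(L/F)|` and `|Gal(L/F)| ≤ |M|`. The first application also yields finiteness of `M`.
  have liM := (linearIndependent_monoidHom Gal(L/F) L).comp φM hφM
  have : Finite M := liM.finite_of_isNoetherian
  have : Fintype M := Fintype.ofFinite M
  have liG := (linearIndependent_monoidHom M L).comp φG hφG
  have h1 := liM.fintype_card_le_finrank
  have h2 := liG.fintype_card_le_finrank
  rw [Module.finrank_fintype_fun_eq_card] at h1 h2
  rw [← IsGalois.card_aut_eq_finrank, Nat.card_eq_fintype_card, Nat.card_eq_fintype_card]
  exact le_antisymm h2 h1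

/-! ### Spectrum of the bi-Cayley graph -/

/-- The characteristic polynomial of a bipartite block matrix. -/
theorem isRoot_charpoly_fromBlocks_zero_zero_iff {n : Type*} [Fintype n] [DecidableEq n]
    {F : Type*} [Field F] (B C : Matrix n n F) (z : F) :
    (Matrix.fromBlocks 0 B C 0).charpoly.IsRoot z ↔ (C * B).charpoly.IsRoot (z ^ 2) := by
  have hexp : Polynomial.expand F 2 (C * B).charpoly =
      (Matrix.scalar n (Polynomial.X ^ 2 : Polynomial F) - (C * B).map Polynomial.C).det := by
    rw [Matrix.charpoly, AlgHom.map_det, Matrix.charmatrix]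
    congr 1
    ext i j : 1
    by_cases h : i = j <;> simp [h, -Matrix.map_mul]
  -- The triangular factor is chosen to clear the upper right block, leaving `X` and `X² - CB` on
  -- the diagonal. Its determinant, that of the scalar matrix `X`, then cancels.
  have hmul : (Matrix.fromBlocks 0 B C 0).charmatrix *
      Matrix.fromBlocks 1 (B.map Polynomial.C) 0 (Matrix.scalar n Polynomial.X) =
      Matrix.fromBlocks (Matrix.scalar n Polynomial.X) 0 (-C.map Polynomial.C)
        (Matrix.scalar n (Polynomial.X ^ 2 : Polynomial F) - (C * B).map Polynomial.C) := by
    rw [Matrix.charmatrix_fromBlocks, Matrix.fromBlocks_multiply, Matrix.map_mul]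
    congr 1
    · simp [Matrix.charmatrix]
    · rw [Matrix.charmatrix, map_zero, sub_zero, neg_mul,
        (Matrix.scalar_commute _ (Commute.all _) _).eq, add_neg_cancel]
    · simp
    · simp [Matrix.charmatrix, sub_eq_add_neg, sq, add_comm]
  have hdet := congrArg Matrix.det hmul
  rw [Matrix.det_mul, Matrix.det_fromBlocks_zero₂₁, Matrix.det_fromBlocks_zero₁₂, Matrix.det_one,
    one_mul, mul_comm, ← hexp] at hdet
  have hX : (Matrix.scalar n (Polynomial.X : Polynomial F)).det ≠ 0 := by
    simp
  have := mul_left_cancel₀ hX hdet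
  rw [Matrix.charpoly, this, Polynomial.IsRoot.def, Polynomial.expand_eval, Polynomial.IsRoot.def]

/-- The spectrum of an element of a finite-dimensional algebra is the set of roots of the
characteristic polynomial of its regular matrix. -/
theorem isRoot_charpoly_leftMulMatrix_iff {n F A : Type*} [Fintype n] [DecidableEq n] [Field F]
    [Ring A] [Algebra F A] (b : Module.Basis n F A) (a : A) (z : F) :
    (Algebra.leftMulMatrix b a).charpoly.IsRoot z ↔ z ∈ spectrum F a := by
  rw [← Matrix.mem_spectrum_iff_isRoot_charpoly]
  have : Module.Finite F A := .of_basis b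
  have hinj := Algebra.leftMulMatrix_injective b
  rw [spectrum.mem_iff, spectrum.mem_iff, ← AlgHom.commutes (Algebra.leftMulMatrix b), ← map_sub,
    not_iff_not]
  refine ⟨fun h => ?_, fun h => h.map _⟩
  set x := algebraMap F A z - a
  -- An invertible regular matrix makes left multiplication by `x` injective, hence surjective by
  -- finite dimension; a preimage of `1` is a right inverse.
  have hx : Function.Surjective (LinearMap.mulLeft F x) := by
    refine (LinearMap.injective_iff_surjective).1 ((injective_iff_map_eq_zero _).2 fun y hy => ?_)
    have : Algebra.leftMulMatrix b x * Algebra.leftMulMatrix b y = 0 := by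
      rw [← map_mul]
      exact (congrArg _ hy).trans (map_zero _)
    exact hinj ((h.mul_right_eq_zero.1 this).trans (map_zero _).symm)
  obtain ⟨y, hy⟩ := hx 1
  refine ⟨⟨x, y, hy, hinj ?_⟩, rfl⟩
  have hy' : x * y = 1 := hy
  rw [map_mul, map_one, mul_eq_one_comm, ← map_mul, hy', map_one]

-- Left multiplication by the sum of `X` has as `(g, h)` entry the multiplicity of `g h⁻¹` in `X`.
-- Since `g₁` is joined to `h₂` when `h g⁻¹ ∈ S`, the inverses of `S` appear in the upper right
-- block.
open Classical in
theorem adjMatrix_BCay {G : Type*} [Group G] [Fintype G] (S : Finset G) :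
    (BCay S).adjMatrix ℂ = Matrix.fromBlocks 0
      (Algebra.leftMulMatrix (MonoidAlgebra.basis G ℂ) (groupAlgebraSum (S.val.map (·⁻¹))))
      (Algebra.leftMulMatrix (MonoidAlgebra.basis G ℂ) (groupAlgebraSum S.val)) 0 := by
  have key : ∀ (X : Multiset G) (g h : G), X.Nodup →
      Algebra.leftMulMatrix (MonoidAlgebra.basis G ℂ) (groupAlgebraSum X) g h =
        if g * h⁻¹ ∈ X then 1 else 0 := by
    intro X g h hX
    have : (MonoidAlgebra.basis G ℂ).repr
        (groupAlgebraSum X * MonoidAlgebra.basis G ℂ h) g = X.count (g * h⁻¹) := by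
      rw [← groupAlgebraSum_coeff]
      have hb : MonoidAlgebra.basis G ℂ h = MonoidAlgebra.single h 1 := rfl
      have hr : ∀ a : MonoidAlgebra ℂ G, (MonoidAlgebra.basis G ℂ).repr a = a.coeff := fun a => rfl
      rw [hb, hr, MonoidAlgebra.coeff_mul_single_apply, mul_one]
    rw [Algebra.leftMulMatrix_eq_repr_mul, this, Multiset.count_eq_of_nodup hX]
    split_ifs <;> simp
  have hnd : (S.val.map (·⁻¹)).Nodup := S.nodup.map inv_injective
  ext (g | g) (h | h)
  · rw [SimpleGraph.adjMatrix_apply]; simp [BCay]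
  · rw [Matrix.fromBlocks_apply₁₂, key _ _ _ hnd, SimpleGraph.adjMatrix_apply]
    refine if_congr ?_ rfl rfl
    constructor
    · rintro (⟨x, s, hs, hx, hy⟩ | ⟨x, s, hs, hx, hy⟩)
      · rw [Sum.inl.inj hx, Sum.inr.inj hy]
        exact Multiset.mem_map.2 ⟨s, hs, by simp⟩
      · exact absurd hx Sum.inr_ne_inl
    · intro h'
      obtain ⟨s, hs, hsg⟩ := Multiset.mem_map.1 h'
      refine Or.inl ⟨g, s, hs, rfl, ?_⟩
      rw [inv_eq_iff_eq_inv.1 hsg, mul_inv_rev, inv_inv, inv_mul_cancel_right]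
  · rw [Matrix.fromBlocks_apply₂₁, key _ _ _ S.nodup, SimpleGraph.adjMatrix_apply]
    refine if_congr ?_ rfl rfl
    constructor
    · rintro (⟨x, s, hs, hx, hy⟩ | ⟨x, s, hs, hx, hy⟩)
      · exact absurd hx Sum.inr_ne_inl
      · rw [Sum.inl.inj hx, Sum.inr.inj hy, mul_inv_cancel_right]
        exact hs
    · exact fun h' => Or.inr ⟨h, _, h', rfl, by rw [inv_mul_cancel_right]⟩
  · rw [SimpleGraph.adjMatrix_apply]; simp [BCay]

open Classical in
/-- The eigenvalues of the bi-Cayley graph of a conjugate-closed set are `± |χ(S)| / χ(1)`. -/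
theorem isRoot_charpoly_BCay_iff {G : Type*} [Group G] [Fintype G] {S : Finset G}
    (hS : ConjugateClosed S) (z : ℂ) :
    ((BCay S).adjMatrix ℂ).charpoly.IsRoot z ↔
      ∃ (n : ℕ) (ρ : Representation ℂ G (Fin n → ℂ)), ρ.IsIrreducible ∧
        z ^ 2 = (((‖charSum ρ.character S.val‖ / n) ^ 2 : ℝ) : ℂ) := by
  rw [adjMatrix_BCay, isRoot_charpoly_fromBlocks_zero_zero_iff, ← map_mul,
    isRoot_charpoly_leftMulMatrix_iff, ← groupAlgebraSum_mulInvMultiset,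
    mem_spectrum_mulInvMultiset_iff hS]

/-! ### Cyclotomic Galois action and the field `K` -/

theorem cyclotomicEta_spec {m : ℕ} [NeZero m] {ω : ℂ} (hω : IsPrimitiveRoot ω m)
    (σ : ℚ⟮ω⟯ ≃ₐ[ℚ] ℚ⟮ω⟯) :
    σ (IntermediateField.AdjoinSimple.gen ℚ ω) =
      IntermediateField.AdjoinSimple.gen ℚ ω ^ (cyclotomicEta hω σ : ZMod m).val :=
  ((isPrimitiveRoot_gen hω).autToPow_spec ℚ σ).symm

theorem isCyclotomicExtension_adjoin {m : ℕ} [NeZero m] {ω : ℂ} (hω : IsPrimitiveRoot ω m) :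
    IsCyclotomicExtension {m} ℚ ℚ⟮ω⟯ := by
  change IsCyclotomicExtension {m} ℚ ℚ⟮ω⟯.toSubalgebra
  rw [IntermediateField.adjoin_simple_toSubalgebra_of_isAlgebraic
    ((hω.isIntegral (NeZero.pos m)).tower_top (A := ℚ)).isAlgebraic]
  exact hω.adjoin_isCyclotomicExtension ℚ

/-- Injectivity is formal; irreducibility of the cyclotomic polynomial over `ℚ` makes the two groups
equinumerous. -/
theorem cyclotomicEta_bijective {m : ℕ} [NeZero m] {ω : ℂ} (hω : IsPrimitiveRoot ω m) :
    Function.Bijective (cyclotomicEta hω) := by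
  have := isCyclotomicExtension_adjoin hω
  have : FiniteDimensional ℚ ℚ⟮ω⟯ := IsCyclotomicExtension.finiteDimensional {m} ℚ ℚ⟮ω⟯
  have hirr : Irreducible (Polynomial.cyclotomic m ℚ) :=
    Polynomial.cyclotomic.irreducible_rat (NeZero.pos m)
  refine (Nat.bijective_iff_injective_and_card _).2
    ⟨(isPrimitiveRoot_gen hω).autToPow_injective ℚ, ?_⟩
  exact Nat.card_congr (IsCyclotomicExtension.autEquivPow ℚ⟮ω⟯ hirr).toEquiv

theorem finrank_fixedSubfield_mul_card {m : ℕ} [NeZero m] {ω : ℂ} (hω : IsPrimitiveRoot ω m)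
    (T : Subgroup (ZMod m)ˣ) :
    Module.finrank ℚ (fixedSubfield hω T) * Nat.card T = m.totient := by
  have := isCyclotomicExtension_adjoin hω
  have : FiniteDimensional ℚ ℚ⟮ω⟯ := IsCyclotomicExtension.finiteDimensional {m} ℚ ℚ⟮ω⟯
  have hcard : Nat.card T = Nat.card (T.comap (cyclotomicEta hω)) :=
    (Nat.card_congr ((Equiv.ofBijective _ (cyclotomicEta_bijective hω)).subtypeEquiv
      fun _ => Iff.rfl)).symm
  rw [hcard, ← IntermediateField.finrank_fixedField_eq_card,
    ← IsCyclotomicExtension.finrank ℚ⟮ω⟯ (Polynomial.cyclotomic.irreducible_rat (NeZero.pos m)),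
    ← Module.finrank_mul_finrank ℚ
      (IntermediateField.fixedField (T.comap (cyclotomicEta hω))) ℚ⟮ω⟯]
  congr 1
  exact (IntermediateField.liftAlgEquiv _).toLinearEquiv.finrank_eq.symm

/-- The Galois group of the cyclotomic field acts on character values through powers. -/
theorem exists_gal_character {G : Type*} [Group G] [Finite G] {ω : ℂ}
    (hω : IsPrimitiveRoot ω (Monoid.exponent G)) {n : ℕ} (ρ : Representation ℂ G (Fin n → ℂ))
    (g : G) : ∃ x : ℚ⟮ω⟯, (x : ℂ) = ρ.character g ∧ ∀ σ : ℚ⟮ω⟯ ≃ₐ[ℚ] ℚ⟮ω⟯,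
      (σ x : ℂ) = ρ.character (g ^ (cyclotomicEta hω σ : ZMod (Monoid.exponent G)).val) := by
  obtain ⟨ι, hι, d, μ, hμ, h⟩ := exists_character_pow_eq_sum ρ g
  choose k hk hk' using fun i => hω.eq_pow_of_pow_eq_one (hμ i)
  refine ⟨∑ i, d i * IntermediateField.AdjoinSimple.gen ℚ ω ^ k i, ?_, fun σ => ?_⟩
  · have h1 := h 1
    rw [pow_one] at h1
    rw [h1]
    push_cast
    simp only [IntermediateField.AdjoinSimple.coe_gen, hk', pow_one]
  · rw [h, map_sum]
    simp only [map_mul, map_natCast, map_pow, cyclotomicEta_spec hω]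
    push_cast
    simp only [IntermediateField.AdjoinSimple.coe_gen, ← hk', ← pow_mul, mul_comm]

theorem exists_gal_charSum {G : Type*} [Group G] [Finite G] {ω : ℂ}
    (hω : IsPrimitiveRoot ω (Monoid.exponent G)) {χ : G → ℂ} (hχ : χ ∈ Irr G) (X : Multiset G) :
    ∃ x : ℚ⟮ω⟯, (x : ℂ) = charSum χ X ∧ ∀ σ : ℚ⟮ω⟯ ≃ₐ[ℚ] ℚ⟮ω⟯,
      (σ x : ℂ) =
        charSum χ (multisetPow X (cyclotomicEta hω σ : ZMod (Monoid.exponent G)).val) := by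
  obtain ⟨n, ρ, -, rfl⟩ := hχ
  induction X using Multiset.induction_on with
  | empty => exact ⟨0, by simp [charSum], by simp [charSum, multisetPow]⟩
  | cons g X ih =>
    obtain ⟨x, hx, hx'⟩ := ih
    obtain ⟨y, hy, hy'⟩ := exists_gal_character hω ρ g
    refine ⟨y + x, ?_, fun σ => ?_⟩
    · rw [charSum, Multiset.map_cons, Multiset.sum_cons, ← hy, ← charSum, ← hx]; rfl
    · rw [multisetPow, Multiset.map_cons, charSum, Multiset.map_cons, Multiset.sum_cons, ← hy' σ,
        ← charSum, ← multisetPow, ← hx' σ, map_add]; rfl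

/-- The fixed field of the power stabilizer of `X` is generated by the character sums over `X`. -/
theorem fixedSubfield_powStabilizer {G : Type*} [Group G] [Finite G] {ω : ℂ}
    (hω : IsPrimitiveRoot ω (Monoid.exponent G)) {X : Multiset G}
    (hX : ∀ g : G, X.map (fun x => g * x * g⁻¹) = X) :
    fixedSubfield hω (powStabilizer X) =
      IntermediateField.adjoin ℚ {z : ℂ | ∃ χ ∈ Irr G, z = charSum χ X} := by
  have := isCyclotomicExtension_adjoin hω
  have : FiniteDimensional ℚ ℚ⟮ω⟯ :=
    IsCyclotomicExtension.finiteDimensional {Monoid.exponent G} ℚ ℚ⟮ω⟯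
  have : IsGalois ℚ ℚ⟮ω⟯ := IsCyclotomicExtension.isGalois {Monoid.exponent G} ℚ ℚ⟮ω⟯
  let D : Set ℚ⟮ω⟯ := {x | ∃ χ ∈ Irr G, (x : ℂ) = charSum χ X}
  have hD : {z : ℂ | ∃ χ ∈ Irr G, z = charSum χ X} = Subtype.val '' D := by
    ext z
    constructor
    · rintro ⟨χ, hχ, rfl⟩
      obtain ⟨x, hx, -⟩ := exists_gal_charSum hω hχ X
      exact ⟨x, ⟨χ, hχ, hx⟩, hx⟩
    · rintro ⟨x, ⟨χ, hχ, hx⟩, rfl⟩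
      exact ⟨χ, hχ, hx⟩
  have hH : (powStabilizer X).comap (cyclotomicEta hω) =
      (IntermediateField.adjoin ℚ D).fixingSubgroup := by
    ext σ
    rw [IntermediateField.mem_fixingSubgroup_iff]
    constructor
    · intro (hσ : multisetPow X _ = X) x hx
      induction hx using IntermediateField.adjoin_induction with
      | mem x hx =>
        obtain ⟨χ, hχ, hx⟩ := hx
        obtain ⟨y, hy, hy'⟩ := exists_gal_charSum hω hχ X
        obtain rfl : x = y := Subtype.ext (hx.trans hy.symm)
        apply Subtype.ext
        rw [hx, hy' σ, hσ]
      | algebraMap f => exact σ.commutes f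
      | add x y _ _ hx hy => rw [map_add, hx, hy]
      | inv x _ hx => rw [map_inv₀, hx]
      | mul x y _ _ hx hy => rw [map_mul, hx, hy]
    -- If `σ` fixes all character sums over `X`, then `X^t` and `X` have equal character sums, and
    -- irreducible characters separate them.
    · intro h
      refine eq_of_charSum_eq (multisetPow_conj hX _) hX fun χ hχ => ?_
      obtain ⟨y, hy, hy'⟩ := exists_gal_charSum hω hχ X
      rw [← hy' σ, ← hy, h y (IntermediateField.subset_adjoin ℚ D ⟨χ, hχ, hy⟩)]
  have hfix := IsGalois.fixedField_fixingSubgroup (IntermediateField.adjoin ℚ D)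
  rw [← hH] at hfix
  rw [hD, ← IntermediateField.lift_adjoin]
  exact congrArg IntermediateField.lift hfix

/-! ### The splitting field and its degree -/

/-- The adjacency matrix has rational entries, so this is the splitting field of a rational
polynomial. Normality supplies the Galois hypothesis of the Kummer argument. -/
theorem finiteDimensional_normal_graphSplittingField {V : Type*} [Fintype V] (Γ : SimpleGraph V) :
    FiniteDimensional ℚ (graphSplittingField Γ) ∧ Normal ℚ (graphSplittingField Γ) := by
  classical
  let p := (Γ.adjMatrix ℚ).charpoly
  have hp : p.map (algebraMap ℚ ℂ) = (Γ.adjMatrix ℂ).charpoly := by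
    rw [← Matrix.charpoly_map]
    congr 1
    ext i j
    simp [SimpleGraph.adjMatrix_apply, apply_ite (algebraMap ℚ ℂ)]
  have hroots : graphSplittingField Γ = IntermediateField.adjoin ℚ (p.rootSet ℂ) := by
    rw [graphSplittingField]
    congr 1
    ext z
    rw [Polynomial.mem_rootSet_of_ne (Matrix.charpoly_monic _).ne_zero, Set.mem_ofPred_eq,
      Polynomial.IsRoot.def, ← Polynomial.eval_map_algebraMap, hp]
  have : Polynomial.IsSplittingField ℚ (IntermediateField.adjoin ℚ (p.rootSet ℂ)) p :=
    IntermediateField.adjoin_rootSet_isSplittingField (IsAlgClosed.splits _)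
  rw [hroots]
  exact ⟨Polynomial.IsSplittingField.finiteDimensional _ p, Normal.of_isSplittingField p⟩

/-- The splitting field of the bi-Cayley graph is generated by the absolute values `|χ(S)|`. -/
theorem graphSplittingField_BCay {G : Type*} [Group G] [Fintype G] {S : Finset G}
    (hS : ConjugateClosed S) :
    graphSplittingField (BCay S) = IntermediateField.adjoin ℚ
      {z : ℂ | ∃ χ ∈ Irr G, z = ((‖charSum χ S.val‖ : ℝ) : ℂ)} := by
  classical
  have hroot : {z : ℂ | ((BCay S).adjMatrix ℂ).charpoly.IsRoot z} =
      {z : ℂ | ∃ (n : ℕ) (ρ : Representation ℂ G (Fin n → ℂ)), ρ.IsIrreducible ∧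
        z ^ 2 = (((‖charSum ρ.character S.val‖ / n) ^ 2 : ℝ) : ℂ)} := by
    ext z
    rw [Set.mem_ofPred_eq, Set.mem_ofPred_eq, ← isRoot_charpoly_BCay_iff hS]
  have hgraph : graphSplittingField (BCay S) = IntermediateField.adjoin ℚ
      {z : ℂ | ∃ (n : ℕ) (ρ : Representation ℂ G (Fin n → ℂ)), ρ.IsIrreducible ∧
        z ^ 2 = (((‖charSum ρ.character S.val‖ / n) ^ 2 : ℝ) : ℂ)} := by
    rw [← hroot, graphSplittingField]
    congr!
  rw [hgraph]
  apply le_antisymm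
  · rw [IntermediateField.adjoin_le_iff]
    rintro z ⟨n, ρ, hρ, hz⟩
    have hm : ((‖charSum ρ.character S.val‖ : ℝ) : ℂ) / n ∈ IntermediateField.adjoin ℚ
        {z : ℂ | ∃ χ ∈ Irr G, z = ((‖charSum χ S.val‖ : ℝ) : ℂ)} :=
      div_mem (IntermediateField.subset_adjoin ℚ _ ⟨_, ⟨n, ρ, hρ, rfl⟩, rfl⟩) (natCast_mem _ n)
    push_cast at hz
    rcases sq_eq_sq_iff_eq_or_eq_neg.1 hz with h | h
    · rw [h]; exact hm
    · rw [h]; exact neg_mem hm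
  · rw [IntermediateField.adjoin_le_iff]
    rintro z ⟨_, ⟨n, ρ, hρ, rfl⟩, rfl⟩
    have hn : (n : ℂ) ≠ 0 := Nat.cast_ne_zero.2 (Representation.IsIrreducible.dim_ne_zero ρ)
    rw [← mul_div_cancel₀ ((‖charSum ρ.character S.val‖ : ℝ) : ℂ) hn, SetLike.mem_coe]
    refine mul_mem (natCast_mem _ n) (IntermediateField.subset_adjoin ℚ _ ⟨n, ρ, hρ, ?_⟩)
    push_cast
    rfl

/-- Kummer theory for exponent two, for subfields of `ℂ` generated by square roots. -/
theorem finrank_adjoin_eq_card_squareClassSubgroup (K : IntermediateField ℚ ℂ) (Z : Set ℂ)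
    (hZ : ∀ z ∈ Z, z ^ 2 ∈ K) [FiniteDimensional K (IntermediateField.adjoin K Z)]
    [IsGalois K (IntermediateField.adjoin K Z)] :
    Module.finrank K (IntermediateField.adjoin K Z) =
      Nat.card (squareClassSubgroup K ((· ^ 2) '' Z)) := by
  let Z' : Set (IntermediateField.adjoin K Z) := {z | (z : ℂ) ∈ Z}
  have hZ' : IntermediateField.adjoin K Z' = ⊤ := by
    apply IntermediateField.lift_injective
    rw [IntermediateField.lift_adjoin, IntermediateField.lift_top]
    congr 1
    ext z
    exact ⟨fun ⟨x, hx, h⟩ => h ▸ hx,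
      fun h => ⟨⟨z, IntermediateField.subset_adjoin K Z h⟩, h, rfl⟩⟩
  rw [finrank_eq_card_squareClasses Z' hZ'
    fun z hz => ⟨⟨_, hZ _ hz⟩, Subtype.ext rfl⟩, squareClassSubgroup]
  refine congrArg (fun A => Nat.card (Subgroup.closure A)) (Set.ext fun c =>
    exists_congr fun u => and_congr_left fun _ => ?_)
  constructor
  · rintro ⟨z, hz, h⟩
    exact ⟨z, hz, (congrArg Subtype.val h).symm⟩
  · rintro ⟨z, hz, h⟩
    exact ⟨⟨z, IntermediateField.subset_adjoin K Z hz⟩, hz, Subtype.ext h.symm⟩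

theorem mainTheorem5 {G : Type*} [Group G] [Fintype G] (S : Finset G) (hS : ConjugateClosed S)
    (ω : ℂ) (hω : IsPrimitiveRoot ω (Monoid.exponent G))
    (T : Subgroup (ZMod (Monoid.exponent G))ˣ) (hT : T = powStabilizer (mulInvMultiset S))
    (K : IntermediateField ℚ ℂ) (hK : K = fixedSubfield hω T) :
    graphSplittingField (BCay S) =
        (IntermediateField.adjoin K
          {z : ℂ | ∃ χ ∈ Irr G, z = ((‖charSum χ S.val‖ : ℝ) : ℂ)}).restrictScalars ℚ ∧
      FiniteDimensional ℚ (graphSplittingField (BCay S)) ∧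
      (∀ χ ∈ Irr G, ((‖charSum χ S.val‖ ^ 2 : ℝ) : ℂ) ∈ K) ∧
      (algebraicDegree (BCay S) : ℚ) =
        (Nat.totient (Monoid.exponent G) : ℚ) *
          (Nat.card (squareClassSubgroup K
            {z : ℂ | ∃ χ ∈ Irr G, z = ((‖charSum χ S.val‖ ^ 2 : ℝ) : ℂ)}) : ℚ) /
          (Nat.card T : ℚ) := by
  set Z : Set ℂ := {z : ℂ | ∃ χ ∈ Irr G, z = ((‖charSum χ S.val‖ : ℝ) : ℂ)} with hZ
  have hdeg := finrank_fixedSubfield_mul_card hω T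
  rw [← hK] at hdeg
  have hKgen : K = IntermediateField.adjoin ℚ
      {z : ℂ | ∃ χ ∈ Irr G, z = charSum χ (mulInvMultiset S)} := by
    rw [hK, hT, fixedSubfield_powStabilizer hω hS.mulInvMultiset_conj]
  have hsq : ∀ χ ∈ Irr G, ((‖charSum χ S.val‖ ^ 2 : ℝ) : ℂ) ∈ K := by
    rintro _ ⟨n, ρ, hρ, rfl⟩
    have hn : (n : ℂ) ≠ 0 := Nat.cast_ne_zero.2 (Representation.IsIrreducible.dim_ne_zero ρ)
    rw [← mul_div_cancel₀ ((‖charSum ρ.character S.val‖ ^ 2 : ℝ) : ℂ) hn,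
      ← charSum_mulInvMultiset hS ρ, hKgen]
    exact mul_mem (natCast_mem _ n) (IntermediateField.subset_adjoin ℚ _ ⟨_, ⟨n, ρ, hρ, rfl⟩, rfl⟩)
  have hKle : K ≤ IntermediateField.adjoin ℚ Z := by
    rw [hKgen, IntermediateField.adjoin_le_iff]
    rintro _ ⟨_, ⟨n, ρ, hρ, rfl⟩, rfl⟩
    rw [charSum_mulInvMultiset hS ρ, Complex.ofReal_pow]
    exact div_mem (pow_mem (IntermediateField.subset_adjoin ℚ Z ⟨_, ⟨n, ρ, hρ, rfl⟩, rfl⟩) 2)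
      (natCast_mem _ n)
  have hSF : graphSplittingField (BCay S) =
      (IntermediateField.adjoin K Z).restrictScalars ℚ := by
    -- Adjoining `Z` to `K` is adjoining `K ∪ Z` to `ℚ`, and `K` is already generated by rational
    -- multiples of squares of elements of `Z`.
    refine Eq.trans ?_ (IntermediateField.restrictScalars_adjoin ℚ K Z).symm
    rw [graphSplittingField_BCay hS]
    refine le_antisymm (IntermediateField.adjoin.mono ℚ _ _ Set.subset_union_right) ?_
    rw [IntermediateField.adjoin_le_iff]
    exact Set.union_subset hKle (IntermediateField.subset_adjoin ℚ Z)
  obtain ⟨hfin, hnor⟩ := finiteDimensional_normal_graphSplittingField (BCay S)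
  refine ⟨hSF, hfin, hsq, ?_⟩
  rw [algebraicDegree, hSF]
  rw [hSF] at hfin hnor
  have hfin' : FiniteDimensional ℚ (IntermediateField.adjoin K Z) := hfin
  have hnor' : Normal ℚ (IntermediateField.adjoin K Z) := hnor
  have : FiniteDimensional K (IntermediateField.adjoin K Z) := .right ℚ K _
  have : Normal K (IntermediateField.adjoin K Z) := Normal.tower_top_of_normal ℚ K _
  have : IsGalois K (IntermediateField.adjoin K Z) := {}
  have hA : (· ^ 2) '' Z = {z : ℂ | ∃ χ ∈ Irr G, z = ((‖charSum χ S.val‖ ^ 2 : ℝ) : ℂ)} := by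
    ext z
    constructor
    · rintro ⟨_, ⟨χ, hχ, rfl⟩, rfl⟩
      exact ⟨χ, hχ, (Complex.ofReal_pow _ 2).symm⟩
    · rintro ⟨χ, hχ, rfl⟩
      exact ⟨_, ⟨χ, hχ, rfl⟩, (Complex.ofReal_pow _ 2).symm⟩
  have hkummer := finrank_adjoin_eq_card_squareClassSubgroup K Z (by
    rintro _ ⟨χ, hχ, rfl⟩
    rw [← Complex.ofReal_pow]
    exact hsq χ hχ)
  rw [hA] at hkummer
  have htower : Module.finrank ℚ ((IntermediateField.adjoin K Z).restrictScalars ℚ) =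
      Module.finrank ℚ K * Module.finrank K (IntermediateField.adjoin K Z) :=
    (Module.finrank_mul_finrank ℚ K (IntermediateField.adjoin K Z)).symm
  have hT0 : (Nat.card T : ℚ) ≠ 0 := Nat.cast_ne_zero.2 Nat.card_pos.ne'
  rw [htower, hkummer, ← hdeg]
  push_cast
  field_simp
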